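/- **Setting.** Let $j\ge 1$ and $\mathfrak p=1^{j+1}0^j$. A binary word is read as a lattice path from the origin: each $1$ is a rise step $x=(1,1)$, each $0$ a fall step $\overline x=(1,-1)$. Let $F$ be the set of binary words with at most as many zeros as ones, and $F^{[\mathfrak p]}\subseteq F$ the set of those in which $\mathfrak p$ does not occur as a block of consecutive letters. A *marked path* is a word $w\in F$ together with a set of occurrences of $\mathfrak p$ in $w$, which are called marked; equivalently, a sequence of the pieces $x$, $\overline x$ and $P$, where $P$ stands for a marked (indivisible) copy of $\mathfrak p$. The peak of a marked occurrence is called a marked point. **The rule.** Consider the labels $(k)$, $k\ge 0$, together with $(0_1)$ and $(0_2)$, both of value $0$, and their marked (overlined) versions. The jumping and marked succession rule is $$(0);\qquad (k)\stackrel{1}{\rightsquigarrow}(0_1)(0_2)(1)\cdots(k+1);\qquad (k)\stackrel{j+1}{\rightsquigarrow}(\overline{0_1})(\overline{0_2})(\overline 1)\cdots(\overline{k+1}).$$ Its tree has a root labelled $(0)$ at level $0$; a node at level $n$ with label value $k$ has $k+3$ sons at level $n+1$ and $k+3$ sons at level $n+j+1$, with the labels listed. The sons of a marked node carry the opposite marks,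 where $\overline{\overline{k}}=k$. **The construction.** Let $\omega$ be a marked path whose endpoint has ordinate $k$. Put $a=x$ for the first production and $a=P$ for the second. For the labels $(0_2),(1),\dots,(k+1)$, that is, for $h=0,1,\dots,k+1$, the son of $\omega$ is $\omega\,a\,\overline x^{\,k+1-h}$. For $(0_1)$, write $\omega\,a\,\overline x^{\,k}=v\varphi$, where $\varphi$ is the rightmost suffix that begins on the $x$-axis and then remains strictly above it. * If $\varphi$ contains no marked point, the son is $v\varphi^{c}x$, where $\varphi^c$ is $\varphi$ with rise and fall steps switched. * Otherwise consider only the points of $\varphi$ that are not strictly inside a marked occurrence. Let $r$ be the rightmost among the marked points of $\varphi$ of highest ordinate; let $t$ be the leftmost of the highest points to the right of the marked occurrence containing $r$ (its final point included); let $z$ be the leftmost of the highest points lying on or above the horizontal line through $t$. Cut $\varphi=\beta\alpha$ at $z$; the son is $v\,\overline x\,\alpha\,\beta$. The generating tree of paths is the directed graph whose nodes are all marked paths, rooted at the empty path, with the edges given by this construction. The level of a marked path is its number of ones (rise steps), its label value is the ordinate of its endpoint, and its label is marked if and only if its number of marked occurrences is odd. **Theorem.** The generating tree of paths is a rooted tree,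 and it is isomorphic to the tree of the succession rule, by an isomorphism that respects the root, the sons (with the production and the label that give them), the levels, the label values and the marks. For this isomorphism, which assigns to each node of the tree of the rule the marked path that it generates: 1. For every $w\in F$ and every set $S$ of occurrences of $\mathfrak p$ in $w$, exactly one node generates $w$ with exactly the occurrences in $S$ marked. The marked patterns of each generated path are occurrences of $\mathfrak p$ in its word, and the label of the node is marked if and only if their number is odd. 2. Every $w\in F$ with exactly $C$ occurrences of $\mathfrak p$ is generated by exactly $2^C$ nodes. If $C\ge1$, then $2^{C-1}$ of these nodes have a marked label and $2^{C-1}$ a non-marked one. If $C=0$, that is $w\in F^{[\mathfrak p]}$, the single node has a non-marked label. 3. For every node whose word $w$ contains $\mathfrak p$, there is exactly one node that generates the same word $w$, with the same marked occurrences except that the last occurrence of $\mathfrak p$ in $w$ is marked if and only if it was not, and that lies on the same level and has the same label value and the opposite mark. 4. Every level of the tree is finite. For all $n,k\ge0$, the number of non-marked nodes of value $k$ at level $n$ minus the number of marked nodes of value $k$ at level $n$ is the number of words in $F^{[\mathfrak p]}$ with $n$ ones whose path ends at ordinate $k$. Likewise, the number of non-marked nodes at level $n$ minus the number of marked ones is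 the number of words in $F^{[\mathfrak p]}$ with $n$ ones. -/

import Mathlib

namespace PatternTree

/-! ### Binary words and the forbidden pattern -/

/-- The ordinate of the endpoint of the lattice path of a binary word: the letter `1` (`true`) is
the rise step `(1, 1)`, the letter `0` (`false`) is the fall step `(1, -1)`. -/
def ordinate (w : List Bool) : ℤ := (w.count true : ℤ) - (w.count false : ℤ)

/-- The class `F` of binary words with at most as many zeros as ones. -/
def InF (w : List Bool) : Prop := w.count false ≤ w.count true

/-- The pattern `1^(j+1) 0^j`. -/
def pattern (j : ℕ) : List Bool := List.replicate (j + 1) true ++ List.replicate j false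

/-- The word avoids the pattern: the pattern is not a block of consecutive letters of it. -/
def Avoids (j : ℕ) (w : List Bool) : Prop := ¬ pattern j <:+: w

/-- The starting indices of the occurrences of the pattern in `w`. -/
def occurrences (j : ℕ) (w : List Bool) : Finset ℕ :=
  (Finset.range (w.length + 1)).filter fun i => pattern j <+: w.drop i

/-! ### Paths with marked forbidden patterns -/

/-- The pieces of a path with marked forbidden patterns: rise steps, fall steps, and marked
forbidden patterns, which are never divided and so are single pieces. -/
inductive Piece
  | rise
  | fall
  | marked
  deriving DecidableEq

/-- The binary word of a single piece. -/
def Piece.word (j : ℕ) : Piece → List Bool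
  | .rise => [true]
  | .fall => [false]
  | .marked => pattern j

/-- The binary word obtained by forgetting the marks. -/
def word (j : ℕ) (ω : List Piece) : List Bool := ω.flatMap (Piece.word j)

/-- The starting indices, in the word of `ω`, of the marked forbidden patterns of `ω`. -/
def markedPositions (j : ℕ) (ω : List Piece) : Finset ℕ :=
  ((Finset.range ω.length).filter fun i => ω[i]? = some Piece.marked).image
    fun i => (word j (ω.take i)).length

/-- The ordinate of the `i`-th point of `ω` among the points that are not strictly within a marked
forbidden pattern (the points between two consecutive pieces and the two endpoints). -/
def ordAt (j : ℕ) (ω : List Piece) (i : ℕ) : ℤ := ordinate (word j (ω.take i))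

/-! ### The cut and paste construction -/

/-- The leftmost index in `s` at which `f` is largest on `s`. -/
def leftmostHighest (f : ℕ → ℤ) (s : Finset ℕ) : ℕ :=
  (s.filter fun i => ∀ i' ∈ s, f i' ≤ f i).min.untopD 0

/-- The rightmost index in `s` at which `f` is largest on `s`. -/
def rightmostHighest (f : ℕ → ℤ) (s : Finset ℕ) : ℕ :=
  (s.filter fun i => ∀ i' ∈ s, f i' ≤ f i).max.unbotD 0

/-- The index of the last point of `ω` that lies on the `x`-axis. (The points strictly within a
marked forbidden pattern need not be inspected: they lie above the initial point of the pattern, so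
a path that ends at ordinate `1` never meets the axis for the last time there.) -/
def lastAxisPoint (j : ℕ) (ω : List Piece) : ℕ :=
  ((Finset.range (ω.length + 1)).filter fun i => ordAt j ω i = 0).max.unbotD 0

/-- The piece number of the marked forbidden pattern containing `r`, the rightmost marked point
(peak of a marked forbidden pattern) of highest ordinate. A peak lies `j + 1` above the initial
point of its pattern. -/
def pieceR (j : ℕ) (φ : List Piece) : ℕ :=
  rightmostHighest (fun i => ordAt j φ i + ((j : ℤ) + 1))
    ((Finset.range φ.length).filter fun i => φ[i]? = some Piece.marked)

/-- The point `t`: the nearest of the highest points on the right of the marked forbidden pattern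
containing `r`. -/
def pointT (j : ℕ) (φ : List Piece) : ℕ :=
  leftmostHighest (ordAt j φ) (Finset.Icc (pieceR j φ + 1) φ.length)

/-- The point `z`: the leftmost of the highest points that lie above or on the horizontal line
through `t`. -/
def pointZ (j : ℕ) (φ : List Piece) : ℕ :=
  leftmostHighest (ordAt j φ)
    ((Finset.range (φ.length + 1)).filter fun i => ordAt j φ (pointT j φ) ≤ ordAt j φ i)

/-- Switching rise and fall steps. It is applied only to paths without marked patterns. -/
def switch : Piece → Piece
  | .rise => .fall
  | .fall => .rise
  | .marked => .marked

/-- The cut and paste actions. The path is written `v φ`, with `φ` the rightmost suffix that begins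
on the `x`-axis and then stays strictly above it. If `φ` has no marked point the result is
`v φᶜ x`; otherwise `φ = β α` is cut at `z` and the result is `v x̄ α β`. -/
def cutPaste (j : ℕ) (ω : List Piece) : List Piece :=
  let i := lastAxisPoint j ω
  let v := ω.take i
  let φ := ω.drop i
  if Piece.marked ∈ φ then
    v ++ Piece.fall :: (φ.drop (pointZ j φ) ++ φ.take (pointZ j φ))
  else
    v ++ φ.map switch ++ [Piece.rise]

/-! ### The succession rule and its tree -/

/-- The labels `(k)` and the two labels `(0₁)`, `(0₂)`. -/
inductive Label
  | num (k : ℕ)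
  | zeroOne
  | zeroTwo
  deriving DecidableEq

/-- The numerical value of a label. -/
def Label.value : Label → ℕ
  | .num k => k
  | .zeroOne => 0
  | .zeroTwo => 0

/-- The two productions: the first one jumps by one level and does not mark, the second one jumps
by `j + 1` levels and marks. -/
inductive Production
  | first
  | second
  deriving DecidableEq

/-- The number of levels by which a production jumps. -/
def Production.jump (j : ℕ) : Production → ℕ
  | .first => 1
  | .second => j + 1

/-- Whether a production marks the labels that it produces. -/
def Production.marks : Production → Bool
  | .first => false
  | .second => true

/-- The piece that a production adds to a path. -/
def Production.piece : Production → Piece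
  | .first => .rise
  | .second => .marked

/-- The labels `(0₁)(0₂)(1)(2)⋯(k+1)` produced by `(k)`. -/
def ruleSons (k : ℕ) : List Label :=
  Label.zeroOne :: Label.zeroTwo :: (List.range (k + 1)).map fun i => Label.num (i + 1)

/-- The value of the last label of a code. A code lists the productions used, with the labels
chosen, on the way from the root to a node, the last one first; the root has the label `(0)`. -/
def codeValue : List (Production × Label) → ℕ
  | [] => (Label.num 0).value
  | e :: _ => e.2.value

/-- The codes of the nodes: each label is one of those produced by the label before it. -/
def IsCode : List (Production × Label) → Prop
  | [] => True
  | e :: c => e.2 ∈ ruleSons (codeValue c) ∧ IsCode c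

/-- The level of a node: the root lies at level `0`. -/
def codeLevel (j : ℕ) (c : List (Production × Label)) : ℕ :=
  (c.map fun e => e.1.jump j).sum

/-- Whether the label of a node is marked; marking a marked label unmarks it. -/
def codeMarked : List (Production × Label) → Bool
  | [] => false
  | e :: c => xor e.1.marks (codeMarked c)

/-- The path obtained from `ω` by the given production for the given label. With `k` the ordinate
of the endpoint of `ω`, the labels `(0₂), (1), …, (k+1)` stand for the ordinates `h = 0, 1, …, k+1`:
the piece of the production followed by `k + 1 - h` fall steps is added to `ω`. For `(0₁)` the piece
followed by `k` fall steps is added and the cut and paste actions are performed. -/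
def construct (j : ℕ) (p : Production) (l : Label) (ω : List Piece) : List Piece :=
  let k := (ordinate (word j ω)).toNat
  match l with
  | .zeroOne => cutPaste j (ω ++ p.piece :: List.replicate k Piece.fall)
  | .zeroTwo => ω ++ p.piece :: List.replicate (k + 1) Piece.fall
  | .num h => ω ++ p.piece :: List.replicate (k + 1 - h) Piece.fall

/-- A rooted directed graph whose edges carry a production and a label and whose nodes carry a
level and a label value that is marked or not. -/
structure LabelledDigraph where
  Node : Type
  root : Node
  /-- `son p l x y`: the node `y` is the son of `x` by the production `p` for the label `l`. -/
  son : Production → Label → Node → Node → Prop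
  level : Node → ℕ
  value : Node → ℕ
  marked : Node → Bool

/-- The digraph is a tree: the root has no parent, every other node has exactly one incoming edge,
and all nodes are descendants of the root. -/
def LabelledDigraph.IsRootedTree (T : LabelledDigraph) : Prop :=
  (∀ p l x, ¬ T.son p l x T.root) ∧
  (∀ y, y ≠ T.root → ∃! e : Production × Label × T.Node, T.son e.1 e.2.1 e.2.2 y) ∧
  ∀ y, Relation.ReflTransGen (fun x x' => ∃ p l, T.son p l x x') T.root y

/-- Isomorphisms of such digraphs respect all of the data. -/
structure LabelledDigraph.Iso (T U : LabelledDigraph) where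
  toEquiv : T.Node ≃ U.Node
  map_root : toEquiv T.root = U.root
  map_son : ∀ p l x y, U.son p l (toEquiv x) (toEquiv y) ↔ T.son p l x y
  map_level : ∀ x, U.level (toEquiv x) = T.level x
  map_value : ∀ x, U.value (toEquiv x) = T.value x
  map_marked : ∀ x, U.marked (toEquiv x) = T.marked x

/-- The tree with root `(0)` defined by the jumping and marked succession rule
`(k) ⇝¹ (0₁)(0₂)(1)⋯(k+1)`, `(k) ⇝^(j+1)` the same labels marked. -/
def ruleTree (j : ℕ) : LabelledDigraph where
  Node := { c : List (Production × Label) // IsCode c }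
  root := ⟨[], trivial⟩
  son p l x y := y.1 = (p, l) :: x.1
  level x := codeLevel j x.1
  value x := codeValue x.1
  marked x := codeMarked x.1

/-- The generating tree of paths: its nodes are all the paths of `F` with some of their forbidden
patterns marked, its edges are given by the construction, the level is the number of rise steps, the
value is the ordinate of the endpoint, and the sign is the parity of the number of marked forbidden
patterns. -/
def pathTree (j : ℕ) : LabelledDigraph where
  Node := { ω : List Piece // InF (word j ω) }
  root := ⟨[], le_refl 0⟩
  son p l x y := l ∈ ruleSons (ordinate (word j x.1)).toNat ∧ y.1 = construct j p l x.1
  level x := (word j x.1).count true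
  value x := (ordinate (word j x.1)).toNat
  marked x := decide (Odd (x.1.count Piece.marked))

/-- The marked path generated by a node of the tree of the rule, under a given isomorphism. -/
def LabelledDigraph.Iso.path {j : ℕ} (e : (ruleTree j).Iso (pathTree j)) (c : (ruleTree j).Node) :
    List Piece :=
  (e.toEquiv c).1

end PatternTree

/-!
The extensions `ω a x̄^m` of a path `ω` of `F` that again end on or above the axis give back all
paths that can be cut before their last piece other than a fall step with the remainder still in
`F`. The paths missed are those ending on the axis with a rise step or a marked pattern that starts
at the level `-1`, and `(0₁)` has to produce each of them once from an extension ending at the level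
`1`. Such an extension is `v φ` with `φ` staying strictly above the axis, and a missed path is `v ψ`
with `ψ` an excursion strictly below it. An unmarked `ψ` is a reflected `φ` followed by a rise step.
A marked `ψ` may end with a marked pattern, but it begins with a fall step, after which it first
rises by `1` at its end; the cycle lemma matches the remainder with a marked `φ`: cutting `φ` at its
leftmost highest point and exchanging the two parts is undone by cutting at the rightmost lowest
point. So every marked path is produced exactly once.

As two occurrences of the pattern never overlap, a marked path is a word together with an arbitrary
set of occurrences, and the signed count of the sets of occurrences of a word is `0`, except for
the words without any occurrence.
-/

namespace PatternTree

/-! ### Heights of paths with integer steps -/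

section Height

variable {σ : Type*}

/-- The ordinate reached from the `x`-axis by a path `ω` of steps taken from an arbitrary alphabet,
the step `p` rising by `s p`. Replacing `s` by `-s` reflects the path in the axis. -/
def height (s : σ → ℤ) (ω : List σ) : ℤ := (ω.map s).sum

/-- Apart from its initial point, the path stays strictly above the level of that point. -/
def StaysAbove (s : σ → ℤ) (φ : List σ) : Prop := ∀ a, a <+: φ → a ≠ [] → 0 < height s a

/-- The cut of the path `β ++ α` between `β` and `α` is at the leftmost of its highest points. -/
structure IsHighestCut (s : σ → ℤ) (β α : List σ) : Prop where
  lt_of_prefix : ∀ b, b <+: β → b ≠ β → height s b < height s β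
  nonpos_of_prefix : ∀ a, a <+: α → height s a ≤ 0

/-- The cut of the path `α ++ β` between `α` and `β` is at the rightmost of its lowest points. -/
structure IsLowestCut (s : σ → ℤ) (α β : List σ) : Prop where
  le_of_prefix : ∀ a, a <+: α → height s α ≤ height s a
  staysAbove : StaysAbove s β

/-- The path reaches the level `1` for the first time at its endpoint. -/
structure IsFirstPassage (s : σ → ℤ) (γ : List σ) : Prop where
  height_eq : height s γ = 1
  nonpos_of_prefix : ∀ c, c <+: γ → c ≠ γ → height s c ≤ 0

/-- The path is nonempty and returns to its initial level at its endpoint, after staying strictly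
below it. -/
structure IsNegativeExcursion (s : σ → ℤ) (ψ : List σ) : Prop where
  ne_nil : ψ ≠ []
  height_eq : height s ψ = 0
  neg_of_prefix : ∀ a, a <+: ψ → a ≠ [] → a ≠ ψ → height s a < 0

/-- The path ends on the `x`-axis with a rise from the level `-1`. -/
def EndsFromBelow (s : σ → ℤ) (ω : List σ) : Prop :=
  ∃ τ p, ω = τ ++ [p] ∧ height s τ = -1 ∧ s p = 1

variable {s : σ → ℤ}

@[simp] lemma height_nil : height s [] = 0 := rfl

@[simp] lemma height_cons (p : σ) (ω : List σ) : height s (p :: ω) = s p + height s ω := by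
  simp [height]

@[simp] lemma height_append (a b : List σ) :
    height s (a ++ b) = height s a + height s b := by
  simp [height]

@[simp] lemma height_reverse (ω : List σ) : height s ω.reverse = height s ω := by
  simp [height, List.sum_reverse]

@[simp] lemma height_neg (ω : List σ) : height (-s) ω = -height s ω := by
  induction ω with
  | nil => rfl
  | cons p ω ih => rw [height_cons, height_cons, ih, Pi.neg_apply, neg_add]

lemma prefix_append_iff {l a b : List σ} :
    l <+: a ++ b ↔ l <+: a ∨ ∃ c, c <+: b ∧ l = a ++ c := by
  constructor
  · rintro ⟨t, h⟩
    rcases List.append_eq_append_iff.1 h with ⟨c, rfl, rfl⟩ | ⟨c, rfl, rfl⟩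
    · exact Or.inl (List.prefix_append l c)
    · exact Or.inr ⟨c, List.prefix_append c t, rfl⟩
  · rintro (h | ⟨c, h, rfl⟩)
    · exact h.trans (List.prefix_append a b)
    · exact (List.prefix_append_right_inj a).2 h

lemma staysAbove_nil : StaysAbove s [] := fun _ ha hne => absurd (List.prefix_nil.1 ha) hne

lemma StaysAbove.concat {φ : List σ} {p : σ} (h : StaysAbove s φ)
    (hp : 0 < height s (φ ++ [p])) : StaysAbove s (φ ++ [p]) := by
  intro a ha hne
  rcases List.prefix_concat_iff.1 ha with rfl | ha
  · exact hp
  · exact h a ha hne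

lemma exists_suffix_staysAbove (hs : ∀ p, s p ≤ 1) (ω : List σ) (h : 0 < height s ω) :
    ∃ v φ, ω = v ++ φ ∧ height s v = 0 ∧ StaysAbove s φ := by
  induction ω using List.reverseRecOn with
  | nil => exact absurd h (lt_irrefl 0)
  | append_singleton ω p ih =>
    simp only [height_append, height_cons, height_nil, add_zero] at h
    rcases lt_or_ge 0 (height s ω) with hω | hω
    · obtain ⟨v, φ, rfl, hv, hφ⟩ := ih hω
      refine ⟨v, φ ++ [p], List.append_assoc v φ [p], hv, hφ.concat ?_⟩
      simpa [hv] using h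
    · have hp := hs p
      exact ⟨ω, [p], rfl, by omega, staysAbove_nil.concat (p := p) (by simp; omega)⟩

lemma exists_isHighestCut (s : σ → ℤ) (φ : List σ) :
    ∃ β α, φ = β ++ α ∧ IsHighestCut s β α := by
  induction φ with
  | nil => exact ⟨[], [], rfl, by simp, by simp⟩
  | cons p φ ih =>
    obtain ⟨β, α, rfl, hβ, hα⟩ := ih
    rcases lt_or_ge 0 (height s (p :: β)) with h | h
    · refine ⟨p :: β, α, rfl, fun b hb hne => ?_, hα⟩
      rcases List.prefix_cons_iff.1 hb with rfl | ⟨t, rfl, ht⟩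
      · exact h
      · simpa using hβ t ht (by rintro rfl; exact hne rfl)
    · refine ⟨[], p :: (β ++ α), rfl, by simp, fun a ha => ?_⟩
      have hle : ∀ t, t <+: β → height s t ≤ height s β := fun t ht => by
        rcases eq_or_ne t β with rfl | hne
        exacts [le_rfl, (hβ t ht hne).le]
      rw [height_cons] at h
      rcases List.prefix_cons_iff.1 ha with rfl | ⟨t, rfl, ht⟩
      · exact le_rfl
      · rw [height_cons]
        rcases prefix_append_iff.1 ht with ht | ⟨c, hc, rfl⟩
        · linarith [hle t ht]
        · linarith [height_append (s := s) β c, hα c hc]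

lemma IsHighestCut.reverse {β α : List σ} (h : IsHighestCut s β α) :
    IsLowestCut s α.reverse β.reverse := by
  refine ⟨?_, ?_⟩
  · rintro a ⟨t, ht⟩
    obtain rfl : t.reverse ++ a.reverse = α := by
      rw [← List.reverse_append, ht, List.reverse_reverse]
    have := h.nonpos_of_prefix t.reverse (List.prefix_append _ _)
    simp only [height_reverse, height_append] at this ⊢
    omega
  · rintro a ⟨t, ht⟩ hne
    obtain rfl : t.reverse ++ a.reverse = β := by
      rw [← List.reverse_append, ht, List.reverse_reverse]
    have := h.lt_of_prefix t.reverse (List.prefix_append _ _) (by simpa using hne)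
    simp only [height_reverse, height_append] at this
    omega

lemma exists_isLowestCut (s : σ → ℤ) (γ : List σ) :
    ∃ α β, γ = α ++ β ∧ IsLowestCut s α β := by
  obtain ⟨β, α, h, hcut⟩ := exists_isHighestCut s γ.reverse
  exact ⟨α.reverse, β.reverse, by rw [← List.reverse_append, ← h, List.reverse_reverse],
    hcut.reverse⟩

lemma IsLowestCut.eq_nil_of_append {α c β β' : List σ} (h : IsLowestCut s α (c ++ β))
    (h' : IsLowestCut s (α ++ c) β') : c = [] := by
  by_contra hc
  have hpos := h.staysAbove c (List.prefix_append c β) hc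
  have hle := h'.le_of_prefix α (List.prefix_append α c)
  rw [height_append] at hle
  omega

lemma IsLowestCut.unique {a b a' b' : List σ} (h : IsLowestCut s a b)
    (h' : IsLowestCut s a' b') (he : a ++ b = a' ++ b') : a = a' ∧ b = b' := by
  rcases List.append_eq_append_iff.1 he with ⟨c, rfl, rfl⟩ | ⟨c, rfl, rfl⟩
  · obtain rfl := h.eq_nil_of_append h'
    simp
  · obtain rfl := h'.eq_nil_of_append h
    simp

/-- With the converse `IsLowestCut.rotate`, the cycle lemma behind the cut and paste actions:
exchanging the two parts of a path turns its leftmost highest point into the rightmost lowest point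
of the new path. -/
lemma IsHighestCut.rotate {β α : List σ} (hcut : IsHighestCut s β α)
    (h : StaysAbove s (β ++ α) ∧ height s (β ++ α) = 1) :
    IsFirstPassage s (α ++ β) ∧ IsLowestCut s α β := by
  obtain ⟨habove, h1⟩ := h
  rw [height_append] at h1
  have hβ : β ≠ [] := by
    rintro rfl
    have := hcut.nonpos_of_prefix α List.prefix_rfl
    simp only [height_nil] at h1
    omega
  refine ⟨⟨by rw [height_append]; omega, fun c hc hne => ?_⟩, fun a ha => ?_, fun b hb =>
    habove b (hb.trans (List.prefix_append β α))⟩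
  · rcases prefix_append_iff.1 hc with hc | ⟨b, hb, rfl⟩
    · exact hcut.nonpos_of_prefix c hc
    · have := hcut.lt_of_prefix b hb (by simpa using hne)
      rw [height_append]
      omega
  · have := habove (β ++ a) ((List.prefix_append_right_inj β).2 ha) (by simp [hβ])
    rw [height_append] at this
    omega

lemma IsLowestCut.rotate {α β : List σ} (hcut : IsLowestCut s α β)
    (h : IsFirstPassage s (α ++ β)) :
    (StaysAbove s (β ++ α) ∧ height s (β ++ α) = 1) ∧ IsHighestCut s β α := by
  obtain ⟨h1, hpass⟩ := h
  rw [height_append] at h1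
  have hβ : β ≠ [] := by
    rintro rfl
    have := hcut.le_of_prefix [] List.nil_prefix
    simp only [height_nil] at h1 this
    omega
  refine ⟨⟨fun a ha hne => ?_, by rw [height_append]; omega⟩, fun b hb hne => ?_, fun a ha => ?_⟩
  · rcases prefix_append_iff.1 ha with ha | ⟨c, hc, rfl⟩
    · exact hcut.staysAbove a ha hne
    · have := hcut.le_of_prefix c hc
      rw [height_append]
      omega
  · have := hpass (α ++ b) ((List.prefix_append_right_inj α).2 hb) (by simpa using hne)
    rw [height_append] at this
    omega
  · refine hpass a (ha.trans (List.prefix_append α β)) ?_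
    rintro rfl
    exact hβ (by simpa using ha.length_le)

lemma isNegativeExcursion_cons_iff {p : σ} {γ : List σ} (hp : s p = -1) :
    IsNegativeExcursion s (p :: γ) ↔ IsFirstPassage s γ := by
  constructor
  · rintro ⟨-, h0, hneg⟩
    rw [height_cons, hp] at h0
    refine ⟨by omega, fun c hc hne => ?_⟩
    have := hneg (p :: c) ((List.prefix_cons_inj p).2 hc) (by simp) (by simpa using hne)
    rw [height_cons, hp] at this
    omega
  · rintro ⟨h1, hnonpos⟩
    refine ⟨by simp, by rw [height_cons]; omega, fun a ha hne hne' => ?_⟩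
    obtain rfl | ⟨c, rfl, hc⟩ := List.prefix_cons_iff.1 ha
    · exact absurd rfl hne
    · have := hnonpos c hc (by simpa using hne')
      rw [height_cons]
      omega

lemma isNegativeExcursion_concat_iff {τ : List σ} {p : σ} (hp : s p = 1) :
    IsNegativeExcursion s (τ ++ [p]) ↔ StaysAbove (-s) τ ∧ height (-s) τ = 1 := by
  have hheight : height s (τ ++ [p]) = height s τ + 1 := by simp [hp]
  rw [height_neg]
  constructor
  · rintro ⟨-, h0, hneg⟩
    refine ⟨fun a ha hne => ?_, by omega⟩
    have := hneg a (ha.trans (List.prefix_append τ [p])) hne (by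
      rintro rfl
      simpa using ha.length_le)
    rw [height_neg]
    omega
  · rintro ⟨hτ, h1⟩
    refine ⟨by simp, by omega, fun a ha hne hne' => ?_⟩
    have := hτ a ((List.prefix_concat_iff.1 ha).resolve_left hne') hne
    rw [height_neg] at this
    omega

lemma IsNegativeExcursion.exists_eq_cons (hs : ∀ p, s p = 1 ∨ s p = -1) {ψ : List σ}
    (h : IsNegativeExcursion s ψ) : ∃ p γ, ψ = p :: γ ∧ s p = -1 := by
  obtain ⟨p, γ, rfl⟩ := List.exists_cons_of_ne_nil h.ne_nil
  refine ⟨p, γ, rfl, (hs p).resolve_left fun hp => ?_⟩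
  have h0 := h.height_eq
  rw [height_cons, hp] at h0
  have := h.neg_of_prefix [p] ⟨γ, rfl⟩ (by simp) (by
    rintro ⟨⟩
    simp at h0)
  rw [height_cons, hp, height_nil] at this
  omega

lemma IsNegativeExcursion.append_inj {v v' ψ ψ' : List σ} (h : IsNegativeExcursion s ψ)
    (h' : IsNegativeExcursion s ψ') (hv : height s v = 0) (hv' : height s v' = 0)
    (he : v ++ ψ = v' ++ ψ') : v = v' ∧ ψ = ψ' := by
  have key : ∀ {u c χ : List σ}, IsNegativeExcursion s (c ++ χ) → χ ≠ [] →
      height s u = 0 → height s (u ++ c) = 0 → c = [] := by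
    intro u c χ hc hχ hu huc
    by_contra hne
    have := hc.neg_of_prefix c (List.prefix_append c χ) hne (by simpa using hχ)
    rw [height_append] at huc
    omega
  rcases List.append_eq_append_iff.1 he with ⟨c, rfl, rfl⟩ | ⟨c, rfl, rfl⟩
  · obtain rfl := key h h'.ne_nil hv hv'
    simp
  · obtain rfl := key h' h.ne_nil hv' hv
    simp

lemma endsFromBelow_iff (hs : ∀ p, s p = 1 ∨ s p = -1) {ω : List σ} :
    EndsFromBelow s ω ↔ ∃ v ψ, ω = v ++ ψ ∧ height s v = 0 ∧ IsNegativeExcursion s ψ := by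
  constructor
  · rintro ⟨τ, p, rfl, hτ, hp⟩
    obtain ⟨v, φ, rfl, hv, hφ⟩ := exists_suffix_staysAbove (s := -s)
      (fun q => by rcases hs q with hq | hq <;> simp [hq]) τ (by rw [height_neg]; omega)
    rw [height_neg, neg_eq_zero] at hv
    rw [height_append] at hτ
    exact ⟨v, φ ++ [p], List.append_assoc v φ [p], hv,
      (isNegativeExcursion_concat_iff hp).2 ⟨hφ, by rw [height_neg]; omega⟩⟩
  · rintro ⟨v, ψ, rfl, hv, hψ⟩
    obtain ⟨τ, p, rfl⟩ : ∃ τ p, ψ = τ ++ [p] :=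
      ⟨_, _, (List.dropLast_append_getLast hψ.ne_nil).symm⟩
    have h0 := hψ.height_eq
    simp only [height_append, height_cons, height_nil, add_zero] at h0
    have hp : s p = 1 := (hs p).resolve_right fun hp => by
      have := hψ.neg_of_prefix τ (List.prefix_append τ [p]) (by rintro rfl; simp [hp] at h0)
        (by simp)
      omega
    exact ⟨v ++ τ, p, (List.append_assoc v τ [p]).symm, by rw [height_append]; omega, hp⟩

end Height

/-! ### Pieces, words and heights -/

/-- The difference of the ordinates of the endpoints of a piece. A marked pattern has one more rise
step than fall steps. -/
def Piece.step : Piece → ℤ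
  | .rise => 1
  | .fall => -1
  | .marked => 1

open Piece (step)

lemma step_eq_one_or_neg_one (p : Piece) : step p = 1 ∨ step p = -1 := by
  cases p <;> simp [step]

@[simp] lemma word_cons (j : ℕ) (p : Piece) (ω : List Piece) :
    word j (p :: ω) = p.word j ++ word j ω := rfl

@[simp] lemma word_append (j : ℕ) (a b : List Piece) :
    word j (a ++ b) = word j a ++ word j b := by simp [word]

lemma ordinate_append (a b : List Bool) : ordinate (a ++ b) = ordinate a + ordinate b := by
  simp only [ordinate, List.count_append, Nat.cast_add]
  ring

lemma ordinate_piece_word (j : ℕ) (p : Piece) : ordinate (p.word j) = step p := by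
  cases p <;> simp [ordinate, Piece.word, pattern, step, List.count_replicate]

lemma ordinate_word (j : ℕ) (ω : List Piece) : ordinate (word j ω) = height step ω := by
  induction ω with
  | nil => rfl
  | cons p ω ih => rw [word_cons, ordinate_append, ordinate_piece_word, height_cons, ih]

lemma ordAt_eq (j : ℕ) (ω : List Piece) (i : ℕ) : ordAt j ω i = height step (ω.take i) :=
  ordinate_word j _

lemma inF_word_iff {j : ℕ} {ω : List Piece} : InF (word j ω) ↔ 0 ≤ height step ω := by
  rw [← ordinate_word j, InF, ordinate]
  omega

lemma height_eq_count (ω : List Piece) :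
    height step ω = ω.count .rise + ω.count .marked - ω.count .fall := by
  induction ω with
  | nil => rfl
  | cons p ω ih =>
    rw [height_cons, ih]
    cases p <;> simp [step] <;> ring

/-! ### The cut and paste actions -/

lemma leftmostHighest_eq {f : ℕ → ℤ} {s : Finset ℕ} {i : ℕ} (hi : i ∈ s)
    (hle : ∀ i' ∈ s, f i' ≤ f i) (hlt : ∀ i' ∈ s, i' < i → f i' < f i) :
    leftmostHighest f s = i := by
  have hmin : (s.filter fun i => ∀ i' ∈ s, f i' ≤ f i).min = (i : WithTop ℕ) := by
    refine le_antisymm (Finset.min_le (Finset.mem_filter.2 ⟨hi, hle⟩))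
      (Finset.le_min fun a ha => WithTop.coe_le_coe.2 ?_)
    obtain ⟨ha, hmax⟩ := Finset.mem_filter.1 ha
    exact not_lt.1 fun h => (hlt a ha h).not_ge (hmax i hi)
  rw [leftmostHighest, hmin]
  rfl

lemma lastAxisPoint_eq (j : ℕ) {v φ : List Piece} (hv : height step v = 0)
    (hφ : StaysAbove step φ) : lastAxisPoint j (v ++ φ) = v.length := by
  have hmax : ((Finset.range ((v ++ φ).length + 1)).filter fun i => ordAt j (v ++ φ) i = 0).max =
      (v.length : WithBot ℕ) := by
    refine le_antisymm (Finset.max_le fun i hi => ?_)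
      (Finset.le_max (by simp [ordAt_eq, hv]))
    simp only [Finset.mem_filter, Finset.mem_range, List.length_append, ordAt_eq] at hi
    obtain ⟨hlen, h0⟩ := hi
    suffices i ≤ v.length from WithBot.coe_le_coe.2 this
    by_contra! hlt
    have hne : φ.take (i - v.length) ≠ [] := by
      rw [Ne, ← List.length_eq_zero_iff, List.length_take]
      omega
    rw [List.take_append, List.take_of_length_le hlt.le, height_append, hv, zero_add] at h0
    exact (hφ _ (List.take_prefix _ φ) hne).ne' h0
  rw [lastAxisPoint, hmax]
  rfl

/-- As `t` is a point of the path, `z` is the leftmost highest point of the whole path, whatever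
`r` and `t` are. -/
lemma pointZ_eq (j : ℕ) {β α : List Piece} (hcut : IsHighestCut step β α) :
    pointZ j (β ++ α) = β.length := by
  have hβ : ordAt j (β ++ α) β.length = height step β := by rw [ordAt_eq, List.take_left]
  have hle : ∀ i, ordAt j (β ++ α) i ≤ height step β := fun i => by
    rw [ordAt_eq]
    rcases prefix_append_iff.1 (List.take_prefix i (β ++ α)) with h | ⟨c, hc, h⟩
    · rcases eq_or_ne ((β ++ α).take i) β with h' | h'
      exacts [(congrArg _ h').le, (hcut.lt_of_prefix _ h h').le]
    · rw [h, height_append]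
      linarith [hcut.nonpos_of_prefix c hc]
  refine leftmostHighest_eq (by simp [hβ, hle]) (fun i _ => hβ ▸ hle i) fun i _ hi => ?_
  rw [hβ, ordAt_eq, List.take_append_of_le_length hi.le]
  refine hcut.lt_of_prefix _ (List.take_prefix i β) fun h => hi.not_ge ?_
  exact List.take_eq_self_iff β |>.1 h

/-- What the cut and paste actions make of the suffix `φ` of a path `v φ`: the path `φᶜ x`, or
`x̄ α β` if `φ = β α` contains a marked point. -/
def pasteTail (j : ℕ) (φ : List Piece) : List Piece :=
  if Piece.marked ∈ φ then Piece.fall :: (φ.drop (pointZ j φ) ++ φ.take (pointZ j φ))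
  else φ.map switch ++ [Piece.rise]

lemma cutPaste_append (j : ℕ) {v φ : List Piece} (hv : height step v = 0)
    (hφ : StaysAbove step φ) : cutPaste j (v ++ φ) = v ++ pasteTail j φ := by
  simp only [cutPaste, lastAxisPoint_eq j hv hφ, List.take_left, List.drop_left, pasteTail,
    apply_ite (v ++ ·), List.append_assoc]

lemma pasteTail_of_mem {j : ℕ} {β α : List Piece} (hm : Piece.marked ∈ β ++ α)
    (hcut : IsHighestCut step β α) : pasteTail j (β ++ α) = Piece.fall :: (α ++ β) := by
  rw [pasteTail, if_pos hm, pointZ_eq j hcut, List.drop_left, List.take_left]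

lemma pasteTail_of_notMem {j : ℕ} {φ : List Piece} (hm : Piece.marked ∉ φ) :
    pasteTail j φ = φ.map switch ++ [Piece.rise] := if_neg hm

lemma switch_involutive : Function.Involutive switch := by
  rintro (_ | _ | _) <;> rfl

lemma marked_mem_map_switch {φ : List Piece} :
    Piece.marked ∈ φ.map switch ↔ Piece.marked ∈ φ :=
  List.mem_map_of_injective (a := Piece.marked) switch_involutive.injective

lemma marked_mem_pasteTail {j : ℕ} {φ : List Piece} :
    Piece.marked ∈ pasteTail j φ ↔ Piece.marked ∈ φ := by
  by_cases hm : Piece.marked ∈ φ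
  · obtain ⟨β, α, rfl, hcut⟩ := exists_isHighestCut step φ
    simp [pasteTail_of_mem hm hcut, or_comm]
  · simp only [pasteTail_of_notMem hm, List.mem_append, marked_mem_map_switch, hm, false_or,
      List.mem_singleton, reduceCtorEq]

lemma height_neg_map_switch {φ : List Piece} (hm : Piece.marked ∉ φ) :
    height (-step) (φ.map switch) = height step φ := by
  rw [height, height, List.map_map]
  refine congrArg List.sum (List.map_congr_left fun p hp => ?_)
  cases p with
  | rise => rfl
  | fall => rfl
  | marked => exact absurd hp hm

lemma staysAbove_neg_map_switch_iff {φ : List Piece} (hm : Piece.marked ∉ φ) :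
    StaysAbove (-step) (φ.map switch) ↔ StaysAbove step φ := by
  constructor
  · intro h a ha hne
    rw [← height_neg_map_switch (mt (ha.subset ·) hm)]
    exact h _ (ha.map switch) (by simpa using hne)
  · intro h b hb hne
    obtain ⟨a, ha, rfl⟩ := List.prefix_map_iff.1 hb
    rw [height_neg_map_switch (mt (ha.subset ·) hm)]
    exact h a ha (by simpa using hne)

lemma mapsTo_pasteTail (j : ℕ) :
    Set.MapsTo (pasteTail j) {φ | StaysAbove step φ ∧ height step φ = 1}
      {ψ | IsNegativeExcursion step ψ} := by
  rintro φ ⟨hφ, h1⟩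
  by_cases hm : Piece.marked ∈ φ
  · obtain ⟨β, α, rfl, hcut⟩ := exists_isHighestCut step φ
    rw [pasteTail_of_mem hm hcut]
    exact (isNegativeExcursion_cons_iff (s := step) rfl).2
      (hcut.rotate ⟨hφ, h1⟩).1
  · rw [pasteTail_of_notMem hm]
    exact (isNegativeExcursion_concat_iff (s := step) rfl).2
      ⟨(staysAbove_neg_map_switch_iff hm).2 hφ, (height_neg_map_switch hm).trans h1⟩

lemma injOn_pasteTail (j : ℕ) :
    Set.InjOn (pasteTail j) {φ | StaysAbove step φ ∧ height step φ = 1} := by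
  intro φ hφ φ' hφ' h
  have hiff : Piece.marked ∈ φ ↔ Piece.marked ∈ φ' := by
    rw [← marked_mem_pasteTail (j := j), h, marked_mem_pasteTail]
  by_cases hm : Piece.marked ∈ φ
  · have hm' := hiff.1 hm
    obtain ⟨β, α, rfl, hcut⟩ := exists_isHighestCut step φ
    obtain ⟨β', α', rfl, hcut'⟩ := exists_isHighestCut step φ'
    rw [pasteTail_of_mem hm hcut, pasteTail_of_mem hm' hcut', List.cons_inj_right] at h
    obtain ⟨rfl, rfl⟩ := (hcut.rotate hφ).2.unique (hcut'.rotate hφ').2 h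
    rfl
  · rw [pasteTail_of_notMem hm, pasteTail_of_notMem (mt hiff.2 hm), List.append_left_inj] at h
    exact List.map_injective_iff.2 switch_involutive.injective h

lemma surjOn_pasteTail (j : ℕ) :
    Set.SurjOn (pasteTail j) {φ | StaysAbove step φ ∧ height step φ = 1}
      {ψ | IsNegativeExcursion step ψ} := by
  intro ψ (hψ : IsNegativeExcursion step ψ)
  by_cases hm : Piece.marked ∈ ψ
  · obtain ⟨p, γ, rfl, hp⟩ := hψ.exists_eq_cons step_eq_one_or_neg_one
    obtain rfl : p = Piece.fall := by cases p <;> simp_all [step]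
    obtain ⟨α, β, rfl, hlow⟩ := exists_isLowestCut step γ
    obtain ⟨hφ, hcut⟩ := hlow.rotate ((isNegativeExcursion_cons_iff hp).1 hψ)
    exact ⟨β ++ α, hφ, pasteTail_of_mem (by simpa [or_comm] using hm) hcut⟩
  · obtain ⟨τ, p, rfl, -, hp⟩ := (endsFromBelow_iff step_eq_one_or_neg_one).2
      ⟨[], ψ, rfl, height_nil, hψ⟩
    obtain rfl : p = Piece.rise := by cases p <;> simp_all [step]
    obtain ⟨hτ, h1⟩ := (isNegativeExcursion_concat_iff hp).1 hψ
    have hτm : Piece.marked ∉ τ.map switch := by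
      rw [marked_mem_map_switch]
      exact fun h => hm (List.mem_append_left _ h)
    have hττ : (τ.map switch).map switch = τ := by simp [switch_involutive.comp_self]
    refine ⟨τ.map switch, ⟨(staysAbove_neg_map_switch_iff hτm).1 (by rwa [hττ]), ?_⟩, ?_⟩
    · rw [← height_neg_map_switch hτm, hττ, h1]
    · rw [pasteTail_of_notMem hτm, hττ]

lemma bijOn_pasteTail (j : ℕ) :
    Set.BijOn (pasteTail j) {φ | StaysAbove step φ ∧ height step φ = 1}
      {ψ | IsNegativeExcursion step ψ} :=
  ⟨mapsTo_pasteTail j, injOn_pasteTail j, surjOn_pasteTail j⟩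

lemma exists_suffix_staysAbove_of_height_eq_one {ω : List Piece} (h : height step ω = 1) :
    ∃ v φ, ω = v ++ φ ∧ height step v = 0 ∧ StaysAbove step φ ∧ height step φ = 1 := by
  obtain ⟨v, φ, rfl, hv, hφ⟩ := exists_suffix_staysAbove (s := step)
    (fun p => by rcases step_eq_one_or_neg_one p with hp | hp <;> omega) ω (by omega)
  rw [height_append, hv, zero_add] at h
  exact ⟨v, φ, rfl, hv, hφ, h⟩

lemma bijOn_cutPaste (j : ℕ) :
    Set.BijOn (cutPaste j) {ω | height step ω = 1} {ω | EndsFromBelow step ω} := by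
  refine ⟨fun ω hω => ?_, fun ω hω ω' hω' h => ?_, fun ω hω => ?_⟩
  · obtain ⟨v, φ, rfl, hv, hφ⟩ := exists_suffix_staysAbove_of_height_eq_one hω
    rw [cutPaste_append j hv hφ.1]
    exact (endsFromBelow_iff step_eq_one_or_neg_one).2
      ⟨v, _, rfl, hv, (bijOn_pasteTail j).mapsTo hφ⟩
  · obtain ⟨v, φ, rfl, hv, hφ⟩ := exists_suffix_staysAbove_of_height_eq_one hω
    obtain ⟨v', φ', rfl, hv', hφ'⟩ := exists_suffix_staysAbove_of_height_eq_one hω'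
    rw [cutPaste_append j hv hφ.1, cutPaste_append j hv' hφ'.1] at h
    obtain ⟨rfl, hpaste⟩ := ((bijOn_pasteTail j).mapsTo hφ).append_inj
      ((bijOn_pasteTail j).mapsTo hφ') hv hv' h
    rw [(bijOn_pasteTail j).injOn hφ hφ' hpaste]
  · obtain ⟨v, ψ, rfl, hv, hψ⟩ := (endsFromBelow_iff step_eq_one_or_neg_one).1 hω
    obtain ⟨φ, ⟨hφ, h1⟩, rfl⟩ := (bijOn_pasteTail j).surjOn hψ
    exact ⟨v ++ φ, by simp [hv, h1], cutPaste_append j hv hφ⟩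

lemma count_map_switch (φ : List Piece) (q : Piece) :
    (φ.map switch).count (switch q) = φ.count q :=
  List.count_map_of_injective φ switch switch_involutive.injective q

lemma count_pasteTail {j : ℕ} {φ : List Piece} {q : Piece} (hq : q ≠ .fall)
    (h : height step φ = 1) : (pasteTail j φ).count q = φ.count q := by
  by_cases hm : Piece.marked ∈ φ
  · obtain ⟨β, α, rfl, hcut⟩ := exists_isHighestCut step φ
    rw [pasteTail_of_mem hm hcut, List.count_cons_of_ne hq.symm, List.count_append,
      List.count_append, add_comm]
  · rw [pasteTail_of_notMem hm, List.count_append]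
    cases q with
    | rise =>
      rw [height_eq_count, List.count_eq_zero_of_not_mem hm] at h
      have := count_map_switch φ .fall
      simp only [switch] at this
      simp only [this, List.count_singleton_self]
      omega
    | fall => exact absurd rfl hq
    | marked => simpa [switch] using count_map_switch φ .marked

lemma count_cutPaste {j : ℕ} {ω : List Piece} {q : Piece} (hq : q ≠ .fall)
    (h : height step ω = 1) : (cutPaste j ω).count q = ω.count q := by
  obtain ⟨v, φ, rfl, hv, hφ, h1⟩ := exists_suffix_staysAbove_of_height_eq_one h
  rw [cutPaste_append j hv hφ, List.count_append, List.count_append, count_pasteTail hq h1]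

/-! ### The sons of a path -/

/-- The path `ω` followed by the piece of the production `p` and `m` fall steps. -/
def extend (p : Production) (m : ℕ) (ω : List Piece) : List Piece :=
  ω ++ p.piece :: List.replicate m Piece.fall

lemma extend_zero (p : Production) (ω : List Piece) : extend p 0 ω = ω ++ [p.piece] := rfl

lemma extend_succ (p : Production) (m : ℕ) (ω : List Piece) :
    extend p (m + 1) ω = extend p m ω ++ [Piece.fall] := by
  simp [extend, List.replicate_succ']

lemma step_piece (p : Production) : step p.piece = 1 := by cases p <;> rfl

lemma piece_ne_fall (p : Production) : p.piece ≠ Piece.fall := by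
  cases p <;> simp [Production.piece]

lemma height_extend (p : Production) (m : ℕ) (ω : List Piece) :
    height step (extend p m ω) = height step ω + 1 - m := by
  induction m with
  | zero => simp [extend_zero, step_piece]
  | succ m ih =>
    rw [extend_succ, height_append, ih]
    simp only [height_cons, height_nil, step]
    omega

lemma height_extend_toNat (p : Production) {ω : List Piece} (h : 0 ≤ height step ω) :
    height step (extend p (height step ω).toNat ω) = 1 := by
  rw [height_extend]
  omega

lemma count_extend {q : Piece} (hq : q ≠ .fall) (p : Production) (m : ℕ) (ω : List Piece) :
    (extend p m ω).count q = (ω ++ [p.piece]).count q := by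
  induction m with
  | zero => rfl
  | succ m ih => rw [extend_succ, List.count_append, ih, List.count_singleton, if_neg (by
      simpa using hq.symm), add_zero]

lemma extend_inj {p p' : Production} {m m' : ℕ} {ω ω' : List Piece}
    (h : extend p m ω = extend p' m' ω') : p = p' ∧ m = m' ∧ ω = ω' := by
  induction m generalizing m' with
  | zero =>
    cases m' with
    | zero =>
      obtain ⟨rfl, hp⟩ := List.append_inj' h rfl
      cases p <;> cases p' <;> simp_all [Production.piece]
    | succ m' =>
      rw [extend_zero, extend_succ] at h
      simpa [piece_ne_fall] using (List.append_inj' h rfl).2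
  | succ m ih =>
    cases m' with
    | zero =>
      rw [extend_zero, extend_succ] at h
      simpa [(piece_ne_fall p').symm] using (List.append_inj' h rfl).2
    | succ m' =>
      rw [extend_succ, extend_succ, List.append_left_inj] at h
      simpa using ih h

lemma exists_eq_extend {ω : List Piece} (hne : ω ≠ []) (h : 0 ≤ height step ω) :
    ∃ p m ω', ω = extend p m ω' := by
  induction ω using List.reverseRecOn with
  | nil => exact absurd rfl hne
  | append_singleton ω q ih =>
    cases q with
    | rise => exact ⟨.first, 0, ω, rfl⟩
    | marked => exact ⟨.second, 0, ω, rfl⟩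
    | fall =>
      simp only [height_append, height_cons, height_nil, step] at h
      obtain ⟨p, m, ω', rfl⟩ := ih (by rintro rfl; simp at h) (by omega)
      exact ⟨p, m + 1, ω', (extend_succ p m ω').symm⟩

lemma not_endsFromBelow_extend_succ (p : Production) (m : ℕ) (ω : List Piece) :
    ¬ EndsFromBelow step (extend p (m + 1) ω) := by
  rintro ⟨τ, q, h, -, hq⟩
  rw [extend_succ] at h
  obtain rfl : Piece.fall = q := by simpa using (List.append_inj' h rfl).2
  simp [step] at hq

lemma num_mem_ruleSons {k h : ℕ} : Label.num h ∈ ruleSons k ↔ 1 ≤ h ∧ h ≤ k + 1 := by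
  simp only [ruleSons, List.mem_cons, reduceCtorEq, List.mem_map, List.mem_range, Label.num.injEq,
    false_or]
  exact ⟨by rintro ⟨a, ha, rfl⟩; omega, fun _ => ⟨h - 1, by omega, by omega⟩⟩

lemma zeroOne_mem_ruleSons (k : ℕ) : Label.zeroOne ∈ ruleSons k := by simp [ruleSons]

lemma zeroTwo_mem_ruleSons (k : ℕ) : Label.zeroTwo ∈ ruleSons k := by simp [ruleSons]

lemma value_le_of_mem_ruleSons {l : Label} {k : ℕ} (hl : l ∈ ruleSons k) : l.value ≤ k + 1 := by
  cases l with
  | num h => exact (num_mem_ruleSons.1 hl).2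
  | zeroOne => exact Nat.zero_le _
  | zeroTwo => exact Nat.zero_le _

lemma eq_of_value_eq {l l' : Label} {k k' : ℕ} (hl : l ∈ ruleSons k) (hl' : l' ∈ ruleSons k')
    (hne : l ≠ .zeroOne) (hne' : l' ≠ .zeroOne) (h : l.value = l'.value) : l = l' := by
  grind [Label.value, num_mem_ruleSons, Label]

lemma exists_mem_ruleSons_value_eq {k h : ℕ} (hk : h ≤ k + 1) :
    ∃ l ∈ ruleSons k, l ≠ .zeroOne ∧ l.value = h := by
  cases h with
  | zero => exact ⟨.zeroTwo, zeroTwo_mem_ruleSons k, by simp, rfl⟩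
  | succ h => exact ⟨.num (h + 1), num_mem_ruleSons.2 ⟨by omega, hk⟩, by simp, rfl⟩

lemma construct_zeroOne (j : ℕ) (p : Production) (ω : List Piece) :
    construct j p .zeroOne ω = cutPaste j (extend p (height step ω).toNat ω) := by
  simp only [construct, ordinate_word, extend]

lemma construct_of_ne (j : ℕ) (p : Production) {l : Label} (hl : l ≠ .zeroOne) (ω : List Piece) :
    construct j p l ω = extend p ((height step ω).toNat + 1 - l.value) ω := by
  cases l <;> simp_all [construct, ordinate_word, extend, Label.value]

lemma endsFromBelow_construct_zeroOne (j : ℕ) (p : Production) {ω : List Piece}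
    (h : 0 ≤ height step ω) : EndsFromBelow step (construct j p .zeroOne ω) := by
  rw [construct_zeroOne]
  exact (bijOn_cutPaste j).mapsTo (height_extend_toNat p h)

lemma height_construct (j : ℕ) (p : Production) {l : Label} {ω : List Piece}
    (h : 0 ≤ height step ω) (hl : l ∈ ruleSons (height step ω).toNat) :
    height step (construct j p l ω) = l.value := by
  by_cases hne : l = .zeroOne
  · subst hne
    obtain ⟨τ, q, hc, hτ, hq⟩ := endsFromBelow_construct_zeroOne j p h
    simp [hc, hτ, hq, Label.value]
  · have := value_le_of_mem_ruleSons hl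
    rw [construct_of_ne j p hne, height_extend]
    omega

lemma count_construct (j : ℕ) (p : Production) (l : Label) {ω : List Piece} {q : Piece}
    (hq : q ≠ .fall) (h : 0 ≤ height step ω) :
    (construct j p l ω).count q = (ω ++ [p.piece]).count q := by
  by_cases hne : l = .zeroOne
  · rw [hne, construct_zeroOne, count_cutPaste hq (height_extend_toNat p h), count_extend hq]
  · rw [construct_of_ne j p hne, count_extend hq]

lemma count_true_word (j : ℕ) (ω : List Piece) :
    (word j ω).count true = ω.count .rise + (j + 1) * ω.count .marked := by
  induction ω with
  | nil => rfl
  | cons p ω ih =>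
    rw [word_cons, List.count_append, ih]
    cases p <;> simp [Piece.word, pattern, List.count_replicate] <;> ring

lemma count_true_construct (j : ℕ) (p : Production) (l : Label) {ω : List Piece}
    (h : 0 ≤ height step ω) :
    (word j (construct j p l ω)).count true = p.jump j + (word j ω).count true := by
  rw [count_true_word, count_true_word, count_construct j p l (by simp) h,
    count_construct j p l (by simp) h]
  cases p <;> simp [Production.jump, Production.piece] <;> ring

lemma construct_ne_nil {j : ℕ} {p : Production} {l : Label} {ω : List Piece}
    (h : 0 ≤ height step ω) : construct j p l ω ≠ [] := by
  intro he
  have := count_construct j p l (piece_ne_fall p) h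
  simp [he] at this

/-- The son for `(0₁)` is told apart from the others of value `0` by its last step: it starts
below the axis. -/
lemma construct_inj {j : ℕ} {p p' : Production} {l l' : Label} {ω ω' : List Piece}
    (h : 0 ≤ height step ω) (h' : 0 ≤ height step ω') (hl : l ∈ ruleSons (height step ω).toNat)
    (hl' : l' ∈ ruleSons (height step ω').toNat)
    (he : construct j p l ω = construct j p' l' ω') : p = p' ∧ l = l' ∧ ω = ω' := by
  have hval : l.value = l'.value := by
    have := height_construct j p h hl
    rw [he, height_construct j p' h' hl'] at this
    omega
  have hlast : ∀ {p p' l' ω ω'}, 0 ≤ height step ω → l' ≠ .zeroOne → Label.value l' = 0 →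
      construct j p .zeroOne ω ≠ construct j p' l' ω' := fun {p p' l' ω ω'} h hne h0 he => by
    have := endsFromBelow_construct_zeroOne j p h
    rw [he, construct_of_ne j p' hne, h0] at this
    exact not_endsFromBelow_extend_succ _ _ _ this
  by_cases hne : l = .zeroOne <;> by_cases hne' : l' = .zeroOne
  · subst hne hne'
    rw [construct_zeroOne, construct_zeroOne] at he
    obtain ⟨hp, -, hω⟩ := extend_inj
      ((bijOn_cutPaste j).injOn (height_extend_toNat p h) (height_extend_toNat p' h') he)
    exact ⟨hp, rfl, hω⟩
  · subst hne
    exact absurd he (hlast h hne' hval.symm)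
  · subst hne'
    exact absurd he.symm (hlast h' hne hval)
  · rw [construct_of_ne j p hne, construct_of_ne j p' hne'] at he
    obtain ⟨hp, -, hω⟩ := extend_inj he
    exact ⟨hp, eq_of_value_eq hl hl' hne hne' hval, hω⟩

lemma exists_construct_eq (j : ℕ) {ω : List Piece} (hne : ω ≠ []) (h : 0 ≤ height step ω) :
    ∃ p l ω', 0 ≤ height step ω' ∧ l ∈ ruleSons (height step ω').toNat ∧
      ω = construct j p l ω' := by
  obtain ⟨p, m, τ, rfl⟩ := exists_eq_extend hne h
  rw [height_extend] at h
  rcases le_or_gt 0 (height step τ) with hτ | hτ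
  · obtain ⟨l, hl, hne', hv⟩ := exists_mem_ruleSons_value_eq (Nat.sub_le _ m)
    refine ⟨p, l, τ, hτ, hl, ?_⟩
    rw [construct_of_ne j p hne', hv]
    congr 1
    omega
  · obtain rfl : m = 0 := by omega
    have hτ' : EndsFromBelow step (extend p 0 τ) := ⟨τ, p.piece, rfl, by omega, step_piece p⟩
    obtain ⟨ω₁, hω₁ : height step ω₁ = 1, hc⟩ := (bijOn_cutPaste j).surjOn hτ'
    obtain ⟨p', m', ω', rfl⟩ := exists_eq_extend (ω := ω₁) (by rintro rfl; simp at hω₁) (by omega)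
    rw [height_extend] at hω₁
    refine ⟨p', .zeroOne, ω', by omega, zeroOne_mem_ruleSons _, ?_⟩
    rw [construct_zeroOne, show (height step ω').toNat = m' by omega, hc]

/-! ### The two trees -/

/-- The path generated by a code. -/
def pathOf (j : ℕ) : List (Production × Label) → List Piece
  | [] => []
  | e :: c => construct j e.1 e.2 (pathOf j c)

lemma height_pathOf (j : ℕ) {c : List (Production × Label)} (hc : IsCode c) :
    height step (pathOf j c) = codeValue c := by
  induction c with
  | nil => rfl
  | cons e c ih =>
    have hheight := ih hc.2
    exact height_construct j e.1 (by omega) (by rw [hheight, Int.toNat_natCast]; exact hc.1)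

lemma height_pathOf_nonneg (j : ℕ) {c : List (Production × Label)} (hc : IsCode c) :
    0 ≤ height step (pathOf j c) := by
  rw [height_pathOf j hc]
  omega

lemma mem_ruleSons_pathOf {j : ℕ} {c : List (Production × Label)} (hc : IsCode c) {l : Label} :
    l ∈ ruleSons (height step (pathOf j c)).toNat ↔ l ∈ ruleSons (codeValue c) := by
  rw [height_pathOf j hc, Int.toNat_natCast]

lemma injOn_pathOf (j : ℕ) : Set.InjOn (pathOf j) {c | IsCode c} := by
  intro c hc c' hc' h
  induction c generalizing c' with
  | nil =>
    cases c' with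
    | nil => rfl
    | cons e' c' => exact absurd h.symm (construct_ne_nil (height_pathOf_nonneg j hc'.2))
  | cons e c ih =>
    cases c' with
    | nil => exact absurd h (construct_ne_nil (height_pathOf_nonneg j hc.2))
    | cons e' c' =>
      obtain ⟨hp, hl, hω⟩ := construct_inj (height_pathOf_nonneg j hc.2)
        (height_pathOf_nonneg j hc'.2) ((mem_ruleSons_pathOf hc.2).2 hc.1)
        ((mem_ruleSons_pathOf hc'.2).2 hc'.1) h
      rw [ih hc.2 hc'.2 hω, Prod.ext hp hl]

lemma exists_pathOf_eq (j : ℕ) (ω : List Piece) (h : 0 ≤ height step ω) :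
    ∃ c, IsCode c ∧ pathOf j c = ω := by
  induction hn : (word j ω).count true using Nat.strong_induction_on generalizing ω with
  | _ n ih =>
  rcases eq_or_ne ω [] with rfl | hne
  · exact ⟨[], trivial, rfl⟩
  · obtain ⟨p, l, ω', h', hl, rfl⟩ := exists_construct_eq j hne h
    rw [count_true_construct j p l h'] at hn
    have hjump : 0 < p.jump j := by cases p <;> simp [Production.jump]
    obtain ⟨c, hc, rfl⟩ := ih _ (by omega) ω' h' rfl
    exact ⟨(p, l) :: c, ⟨(mem_ruleSons_pathOf hc).1 hl, hc⟩, rfl⟩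

lemma codeLevel_eq (j : ℕ) {c : List (Production × Label)} (hc : IsCode c) :
    codeLevel j c = (word j (pathOf j c)).count true := by
  induction c with
  | nil => rfl
  | cons e c ih =>
    rw [pathOf, count_true_construct j _ _ (height_pathOf_nonneg j hc.2), ← ih hc.2]
    simp only [codeLevel, List.map_cons, List.sum_cons]

lemma codeMarked_eq (j : ℕ) {c : List (Production × Label)} (hc : IsCode c) :
    codeMarked c = decide (Odd ((pathOf j c).count Piece.marked)) := by
  induction c with
  | nil => simp [codeMarked, pathOf]
  | cons e c ih =>
    rw [pathOf, count_construct j _ _ (by simp) (height_pathOf_nonneg j hc.2), codeMarked, ih hc.2]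
    cases e.1 <;> simp [Production.marks, Production.piece, Nat.odd_add_one, -Nat.not_odd_iff_even]

/-- The path generated by a node of the tree of the rule, as a node of the tree of paths. -/
def pathNode (j : ℕ) (c : (ruleTree j).Node) : (pathTree j).Node :=
  ⟨pathOf j c.1, inF_word_iff.2 (height_pathOf_nonneg j c.2)⟩

lemma bijective_pathNode (j : ℕ) : Function.Bijective (pathNode j) := by
  refine ⟨fun c c' h => Subtype.ext (injOn_pathOf j c.2 c'.2 (congrArg Subtype.val h)),
    fun ω => ?_⟩
  obtain ⟨c, hc, h⟩ := exists_pathOf_eq j ω.1 (inF_word_iff.1 ω.2)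
  exact ⟨⟨c, hc⟩, Subtype.ext h⟩

lemma son_pathNode_iff {j : ℕ} {p : Production} {l : Label} {x y : (ruleTree j).Node} :
    (pathTree j).son p l (pathNode j x) (pathNode j y) ↔ (ruleTree j).son p l x y := by
  change l ∈ ruleSons (ordinate (word j (pathOf j x.1))).toNat ∧
    pathOf j y.1 = construct j p l (pathOf j x.1) ↔ y.1 = (p, l) :: x.1
  rw [ordinate_word, mem_ruleSons_pathOf x.2]
  constructor
  · rintro ⟨hl, h⟩
    exact injOn_pathOf j y.2 (show IsCode ((p, l) :: x.1) from ⟨hl, x.2⟩) h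
  · intro h
    have hy : IsCode y.1 := y.2
    rw [h] at hy ⊢
    exact ⟨hy.1, rfl⟩

/-- The isomorphism of the tree of the rule and the tree of paths. -/
noncomputable def treeIso (j : ℕ) : (ruleTree j).Iso (pathTree j) where
  toEquiv := Equiv.ofBijective (pathNode j) (bijective_pathNode j)
  map_root := rfl
  map_son _ _ _ _ := son_pathNode_iff
  map_level x := (codeLevel_eq j x.2).symm
  map_value x := by
    change (ordinate (word j (pathOf j x.1))).toNat = codeValue x.1
    rw [ordinate_word, height_pathOf j x.2, Int.toNat_natCast]
  map_marked x := (codeMarked_eq j x.2).symm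

lemma ruleTree_isRootedTree (j : ℕ) : (ruleTree j).IsRootedTree := by
  refine ⟨fun p l x h => List.cons_ne_nil _ _ (Eq.symm h), ?_, ?_⟩
  · rintro ⟨c, hc⟩ hne
    cases c with
    | nil => exact absurd rfl hne
    | cons e c =>
      refine ⟨(e.1, e.2, ⟨c, hc.2⟩), rfl, ?_⟩
      rintro ⟨p, l, x, hx⟩ h
      obtain ⟨rfl, rfl⟩ := List.cons.inj h
      rfl
  · rintro ⟨c, hc⟩
    induction c with
    | nil => exact .refl
    | cons e c ih => exact (ih hc.2).tail ⟨e.1, e.2, rfl⟩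

lemma LabelledDigraph.Iso.isRootedTree {T U : LabelledDigraph} (e : T.Iso U)
    (h : T.IsRootedTree) : U.IsRootedTree := by
  obtain ⟨hroot, hparent, hreach⟩ := h
  refine ⟨fun p l x hx => ?_, fun y hy => ?_, fun y => ?_⟩
  · obtain ⟨x, rfl⟩ := e.toEquiv.surjective x
    rw [← e.map_root, e.map_son] at hx
    exact hroot p l x hx
  · obtain ⟨y, rfl⟩ := e.toEquiv.surjective y
    obtain ⟨⟨p, l, x⟩, hx, huniq⟩ := hparent y (by rintro rfl; exact hy e.map_root)
    refine ⟨(p, l, e.toEquiv x), (e.map_son _ _ _ _).2 hx, ?_⟩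
    rintro ⟨p', l', x'⟩ hx'
    obtain ⟨x', rfl⟩ := e.toEquiv.surjective x'
    obtain ⟨rfl, rfl, rfl⟩ : p' = p ∧ l' = l ∧ x' = x := by
      simpa only [Prod.mk.injEq] using huniq (p', l', x') ((e.map_son _ _ _ _).1 hx')
    rfl
  · obtain ⟨y, rfl⟩ := e.toEquiv.surjective y
    rw [← e.map_root]
    refine Relation.ReflTransGen.lift e.toEquiv ?_ _ _ (hreach y)
    rintro x x' ⟨p, l, hx⟩
    exact ⟨p, l, (e.map_son _ _ _ _).2 hx⟩

/-! ### Marked paths as words with chosen occurrences of the pattern -/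

lemma mem_markedPositions {j : ℕ} {ω : List Piece} {i : ℕ} : i ∈ markedPositions j ω ↔
    ∃ a b, ω = a ++ Piece.marked :: b ∧ (word j a).length = i := by
  simp only [markedPositions, Finset.mem_image, Finset.mem_filter, Finset.mem_range]
  constructor
  · rintro ⟨n, ⟨hn, hn'⟩, rfl⟩
    rw [List.getElem?_eq_getElem hn, Option.some.injEq] at hn'
    exact ⟨ω.take n, ω.drop (n + 1), by
      rw [← hn', List.cons_getElem_drop_succ, List.take_append_drop], rfl⟩
  · rintro ⟨a, b, rfl, rfl⟩
    exact ⟨a.length, by simp, by simp⟩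

lemma markedPositions_nil (j : ℕ) : markedPositions j [] = ∅ := by
  ext
  simp [mem_markedPositions]

lemma mem_markedPositions_cons {j : ℕ} {p : Piece} {ω : List Piece} {i : ℕ} :
    i ∈ markedPositions j (p :: ω) ↔ (p = Piece.marked ∧ i = 0) ∨
      ∃ i' ∈ markedPositions j ω, i = (p.word j).length + i' := by
  simp only [mem_markedPositions]
  constructor
  · rintro ⟨a, b, h, rfl⟩
    rcases List.cons_eq_append_iff.1 h with ⟨rfl, hcons⟩ | ⟨a', rfl, rfl⟩
    · exact Or.inl ⟨(List.cons.inj hcons).1.symm, rfl⟩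
    · exact Or.inr ⟨_, ⟨a', b, rfl, rfl⟩, by simp⟩
  · rintro (⟨rfl, rfl⟩ | ⟨i', ⟨a, b, rfl, rfl⟩, rfl⟩)
    · exact ⟨[], ω, rfl, rfl⟩
    · exact ⟨p :: a, b, rfl, by simp⟩

lemma length_pattern (j : ℕ) : (pattern j).length = 2 * j + 1 := by
  simp only [pattern, List.length_append, List.length_replicate]
  omega

lemma length_piece_word_pos (j : ℕ) (p : Piece) : 0 < (p.word j).length := by
  cases p <;> simp [Piece.word, length_pattern]

lemma zero_mem_markedPositions_cons {j : ℕ} {p : Piece} {ω : List Piece} :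
    0 ∈ markedPositions j (p :: ω) ↔ p = Piece.marked := by
  have := length_piece_word_pos j p
  rw [mem_markedPositions_cons, and_iff_left rfl, or_iff_left]
  rintro ⟨i', -, h⟩
  omega

lemma add_mem_markedPositions_cons {j : ℕ} {p : Piece} {ω : List Piece} {i : ℕ} :
    (p.word j).length + i ∈ markedPositions j (p :: ω) ↔ i ∈ markedPositions j ω := by
  have := length_piece_word_pos j p
  rw [mem_markedPositions_cons, or_iff_right (by omega)]
  simp only [Nat.add_left_cancel_iff, exists_eq_right']

lemma card_markedPositions (j : ℕ) (ω : List Piece) :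
    (markedPositions j ω).card = ω.count Piece.marked := by
  induction ω with
  | nil => simp [markedPositions_nil]
  | cons p ω ih =>
    have himage : markedPositions j (p :: ω) = (if p = Piece.marked then {0} else ∅) ∪
        (markedPositions j ω).image fun i => (p.word j).length + i := by
      ext i
      rw [mem_markedPositions_cons, Finset.mem_union, Finset.mem_image]
      split_ifs with h <;> simp [h, eq_comm]
    have hpos := length_piece_word_pos j p
    rw [himage, Finset.card_union_of_disjoint, Finset.card_image_of_injective _
      (add_right_injective _), ih, List.count_cons]
    · cases p <;> simp [add_comm]
    · split_ifs
      · rw [Finset.disjoint_singleton_left, Finset.mem_image]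
        rintro ⟨a, -, h⟩
        omega
      · exact Finset.disjoint_empty_left _

lemma mem_occurrences {j : ℕ} {w : List Bool} {i : ℕ} :
    i ∈ occurrences j w ↔ pattern j <+: w.drop i := by
  rw [occurrences, Finset.mem_filter, Finset.mem_range, and_iff_right_iff_imp]
  intro h
  have := h.length_le
  rw [length_pattern, List.length_drop] at this
  omega

lemma avoids_iff {j : ℕ} {w : List Bool} : Avoids j w ↔ occurrences j w = ∅ := by
  rw [Avoids, Finset.eq_empty_iff_forall_notMem, ← not_exists, not_iff_not]
  simp only [mem_occurrences]
  constructor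
  · rintro ⟨s, t, rfl⟩
    exact ⟨s.length, by simp [List.append_assoc]⟩
  · rintro ⟨i, hi⟩
    exact hi.isInfix.trans (List.drop_suffix i w).isInfix

lemma markedPositions_subset (j : ℕ) (ω : List Piece) :
    markedPositions j ω ⊆ occurrences j (word j ω) := by
  intro i hi
  obtain ⟨a, b, rfl, rfl⟩ := mem_markedPositions.1 hi
  rw [mem_occurrences, word_append, List.drop_left, word_cons]
  exact List.prefix_append _ _

lemma getElem?_of_pattern_prefix_drop {j : ℕ} {w : List Bool} {i k : ℕ}
    (h : pattern j <+: w.drop i) (hk : k < 2 * j + 1) :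
    w[i + k]? = some (decide (k < j + 1)) := by
  obtain ⟨t, ht⟩ := h
  rw [← List.getElem?_drop, ← ht, List.getElem?_append_left (by rwa [length_pattern]), pattern,
    List.getElem?_append, List.getElem?_replicate, List.getElem?_replicate, List.length_replicate]
  split_ifs <;> first | omega | simp_all

/-- An occurrence that started inside another one would read a fall as a rise: at the first fall
of the earlier occurrence if it starts among the rises, at its own start otherwise. -/
lemma le_of_pattern_prefix_drop {j : ℕ} {w : List Bool} {i : ℕ} (h0 : pattern j <+: w.drop 0)
    (hi : pattern j <+: w.drop i) (hpos : 0 < i) : 2 * j + 1 ≤ i := by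
  by_contra hlt
  rcases le_or_gt i j with hij | hij
  · have hfall := getElem?_of_pattern_prefix_drop h0 (k := j + 1) (by omega)
    have hrise := getElem?_of_pattern_prefix_drop hi (k := j + 1 - i) (by omega)
    rw [show i + (j + 1 - i) = 0 + (j + 1) by omega, hfall, Option.some.injEq,
      decide_eq_decide] at hrise
    omega
  · have hfall := getElem?_of_pattern_prefix_drop h0 (k := i) (by omega)
    have hrise := getElem?_of_pattern_prefix_drop hi (k := 0) (by omega)
    rw [show i + 0 = 0 + i by omega, hfall, Option.some.injEq, decide_eq_decide] at hrise
    omega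

lemma exists_piece_word_eq_singleton (j : ℕ) (b : Bool) :
    ∃ p : Piece, p ≠ Piece.marked ∧ p.word j = [b] := by
  cases b
  · exact ⟨.fall, by simp, rfl⟩
  · exact ⟨.rise, by simp, rfl⟩

lemma exists_eq_piece_word_append {j : ℕ} {w : List Bool} (hw : w ≠ []) {S : Finset ℕ}
    (hS : S ⊆ occurrences j w) : ∃ (p : Piece) (w' : List Bool), w = p.word j ++ w' ∧
      (p = Piece.marked ↔ 0 ∈ S) ∧ ∀ i ∈ S, 0 < i → (p.word j).length ≤ i := by
  have hocc : ∀ i ∈ S, pattern j <+: w.drop i := fun i hi => mem_occurrences.1 (hS hi)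
  by_cases h0 : 0 ∈ S
  · obtain ⟨w', hw'⟩ := hocc 0 h0
    refine ⟨.marked, w', hw'.symm, by simp only [h0], fun i hi hpos => ?_⟩
    rw [Piece.word, length_pattern]
    exact le_of_pattern_prefix_drop (hocc 0 h0) (hocc i hi) hpos
  · obtain ⟨b, w', rfl⟩ := List.exists_cons_of_ne_nil hw
    obtain ⟨p, hp, hword⟩ := exists_piece_word_eq_singleton j b
    refine ⟨p, w', by simp [hword], by simp only [hp, h0], fun i _ hpos => ?_⟩
    rw [hword]
    exact hpos

lemma exists_markedPositions_eq (j : ℕ) (w : List Bool) (S : Finset ℕ)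
    (hS : S ⊆ occurrences j w) : ∃ ω, word j ω = w ∧ markedPositions j ω = S := by
  induction hn : w.length using Nat.strong_induction_on generalizing w S with
  | _ n ih =>
  rcases eq_or_ne w [] with rfl | hw
  · rw [avoids_iff.1 fun h => by simpa [length_pattern] using h.length_le,
      Finset.subset_empty] at hS
    exact ⟨[], rfl, by rw [markedPositions_nil, hS]⟩
  · obtain ⟨p, w', rfl, hp, hgap⟩ := exists_eq_piece_word_append hw hS
    have hpos := length_piece_word_pos j p
    have hS' : (S.preimage (fun i => (p.word j).length + i) (add_right_injective _).injOn) ⊆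
        occurrences j w' := fun i hi => by
      have := mem_occurrences.1 (hS (Finset.mem_preimage.1 hi))
      rwa [List.drop_length_add_append, ← mem_occurrences] at this
    obtain ⟨ω, rfl, hω⟩ := ih w'.length (by rw [List.length_append] at hn; omega) w' _ hS' rfl
    refine ⟨p :: ω, word_cons j p ω, ?_⟩
    ext i
    rcases Nat.eq_zero_or_pos i with rfl | hi
    · rw [zero_mem_markedPositions_cons, hp]
    rcases lt_or_ge i (p.word j).length with hlt | hle
    · refine iff_of_false (fun h => ?_) fun h => (hgap i h hi).not_gt hlt
      rcases mem_markedPositions_cons.1 h with ⟨-, h⟩ | ⟨i', -, h⟩ <;> omega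
    · obtain ⟨i', rfl⟩ := Nat.exists_eq_add_of_le hle
      rw [add_mem_markedPositions_cons, hω, Finset.mem_preimage]

lemma word_eq_nil {j : ℕ} {ω : List Piece} (h : word j ω = []) : ω = [] := by
  cases ω with
  | nil => rfl
  | cons p ω =>
    rw [word_cons, List.append_eq_nil_iff] at h
    exact absurd (congrArg List.length h.1) (length_piece_word_pos j p).ne'

lemma eq_of_word_eq_of_markedPositions_eq {j : ℕ} {ω ω' : List Piece}
    (hw : word j ω = word j ω') (hm : markedPositions j ω = markedPositions j ω') : ω = ω' := by
  induction ω generalizing ω' with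
  | nil => exact (word_eq_nil hw.symm).symm
  | cons p ω ih =>
    cases ω' with
    | nil => exact word_eq_nil hw
    | cons q ω' =>
      have hpq : p = Piece.marked ↔ q = Piece.marked := by
        rw [← zero_mem_markedPositions_cons (j := j), hm, zero_mem_markedPositions_cons]
      obtain rfl : p = q := by
        cases p <;> cases q <;> simp_all [Piece.word]
      rw [word_cons, word_cons] at hw
      rw [ih (List.append_cancel_left hw) ?_]
      ext i
      rw [← add_mem_markedPositions_cons, hm, add_mem_markedPositions_cons]

lemma finite_setOf_inF_count_true_eq (n : ℕ) : {w | InF w ∧ w.count true = n}.Finite := by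
  refine (List.finite_length_le Bool (2 * n)).subset ?_
  rintro w ⟨hw : w.count false ≤ w.count true, rfl⟩
  have := List.count_true_add_count_false w
  change w.length ≤ _
  omega

/-! ### Counting nodes by subsets of occurrences -/

section Powerset

variable {α : Type*}

lemma odd_card_symmDiff_singleton [DecidableEq α] (s : Finset α) (a : α) :
    Odd (symmDiff s {a}).card ↔ ¬ Odd s.card := by
  by_cases ha : a ∈ s
  · rw [symmDiff_of_ge (Finset.singleton_subset_iff.2 ha), Finset.sdiff_singleton_eq_erase,
      ← Finset.card_erase_add_one ha, Nat.odd_add_one, not_not]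
  · rw [(Finset.disjoint_singleton_right.2 ha).symmDiff_eq_sup, Finset.sup_eq_union,
      Finset.union_singleton, Finset.card_insert_of_notMem ha, Nat.odd_add_one]

lemma card_even_sub_card_odd [DecidableEq α] (s : Finset α) :
    ((s.powerset.filter fun t => Even t.card).card : ℤ) -
      (s.powerset.filter fun t => Odd t.card).card = if s = ∅ then 1 else 0 := by
  rw [← Finset.sum_powerset_neg_one_pow_card,
    ← Finset.sum_filter_add_sum_filter_not s.powerset fun t => Even t.card]
  simp only [Nat.not_even_iff_odd]
  rw [Finset.sum_congr rfl fun t ht => (Finset.mem_filter.1 ht).2.neg_one_pow,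
    Finset.sum_congr (s₁ := s.powerset.filter fun t => Odd t.card) rfl fun t ht =>
      (Finset.mem_filter.1 ht).2.neg_one_pow]
  simp only [Finset.sum_const, nsmul_eq_mul, mul_one, mul_neg]
  ring

lemma card_odd_and_card_even_powerset {s : Finset α} (hs : s.Nonempty) :
    (s.powerset.filter fun t => Odd t.card).card = 2 ^ (s.card - 1) ∧
      (s.powerset.filter fun t => Even t.card).card = 2 ^ (s.card - 1) := by
  classical
  have hdiff := card_even_sub_card_odd s
  have hsum := Finset.card_filter_add_card_filter_not (s := s.powerset) fun t => Odd t.card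
  simp only [Nat.not_odd_iff_even] at hsum
  rw [if_neg hs.ne_empty] at hdiff
  have hpow : 2 ^ s.card = 2 ^ (s.card - 1) * 2 := by
    rw [← pow_succ, Nat.sub_add_cancel hs.card_pos]
  rw [Finset.card_powerset] at hsum
  omega

end Powerset

namespace LabelledDigraph.Iso

variable {j : ℕ} (e : (ruleTree j).Iso (pathTree j))

lemma inF_word_path (c : (ruleTree j).Node) : InF (word j (e.path c)) := (e.toEquiv c).2

lemma eq_of_word_eq {c c' : (ruleTree j).Node} (hw : word j (e.path c) = word j (e.path c'))
    (hm : markedPositions j (e.path c) = markedPositions j (e.path c')) : c = c' :=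
  e.toEquiv.injective (Subtype.ext (eq_of_word_eq_of_markedPositions_eq hw hm))

lemma existsUnique_node {w : List Bool} (hw : InF w) {S : Finset ℕ} (hS : S ⊆ occurrences j w) :
    ∃! c, word j (e.path c) = w ∧ markedPositions j (e.path c) = S := by
  obtain ⟨ω, rfl, rfl⟩ := exists_markedPositions_eq j w S hS
  obtain ⟨c, hc⟩ := e.toEquiv.surjective ⟨ω, hw⟩
  obtain rfl : e.path c = ω := congrArg Subtype.val hc
  exact ⟨c, ⟨rfl, rfl⟩, fun c' h => e.eq_of_word_eq h.1 h.2⟩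

lemma level_eq (c : (ruleTree j).Node) :
    (ruleTree j).level c = (word j (e.path c)).count true := (e.map_level c).symm

lemma value_eq (c : (ruleTree j).Node) :
    (ruleTree j).value c = (ordinate (word j (e.path c))).toNat := (e.map_value c).symm

lemma value_eq_iff {c : (ruleTree j).Node} {k : ℕ} :
    (ruleTree j).value c = k ↔ ordinate (word j (e.path c)) = k := by
  have : 0 ≤ ordinate (word j (e.path c)) := by
    rw [ordinate_word]
    exact inF_word_iff.1 (e.inF_word_path c)
  rw [e.value_eq]
  omega

lemma marked_iff {c : (ruleTree j).Node} :
    (ruleTree j).marked c = true ↔ Odd (markedPositions j (e.path c)).card := by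
  rw [← e.map_marked c, card_markedPositions]
  exact decide_eq_true_iff

lemma not_marked_iff {c : (ruleTree j).Node} :
    (ruleTree j).marked c = false ↔ Even (markedPositions j (e.path c)).card := by
  rw [← Bool.not_eq_true, e.marked_iff, Nat.not_odd_iff_even]

lemma bijOn_word_markedPositions {A : Finset (List Bool)} (hA : ∀ w ∈ A, InF w)
    (Q : Finset ℕ → Prop) [DecidablePred Q] :
    Set.BijOn (fun c => (⟨word j (e.path c), markedPositions j (e.path c)⟩ :
        Σ _ : List Bool, Finset ℕ))
      {c | word j (e.path c) ∈ A ∧ Q (markedPositions j (e.path c))}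
      (A.sigma fun w => (occurrences j w).powerset.filter Q) := by
  refine ⟨fun c hc => ?_, fun c _ c' _ h => ?_, ?_⟩
  · rw [Finset.mem_coe, Finset.mem_sigma, Finset.mem_filter, Finset.mem_powerset]
    exact ⟨hc.1, markedPositions_subset j _, hc.2⟩
  · obtain ⟨hw, hm⟩ := Sigma.mk.inj h
    exact e.eq_of_word_eq hw (eq_of_heq hm)
  · rintro ⟨w, S⟩ h
    rw [Finset.mem_coe, Finset.mem_sigma, Finset.mem_filter, Finset.mem_powerset] at h
    obtain ⟨c, ⟨rfl, rfl⟩, -⟩ := e.existsUnique_node (hA w h.1) h.2.1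
    exact ⟨c, ⟨h.1, h.2.2⟩, rfl⟩

lemma ncard_setOf_word_mem {A : Finset (List Bool)} (hA : ∀ w ∈ A, InF w) (Q : Finset ℕ → Prop)
    [DecidablePred Q] :
    {c | word j (e.path c) ∈ A ∧ Q (markedPositions j (e.path c))}.ncard =
      ∑ w ∈ A, ((occurrences j w).powerset.filter Q).card := by
  rw [(e.bijOn_word_markedPositions hA Q).ncard_eq, Set.ncard_coe_finset, Finset.card_sigma]

lemma ncard_setOf_word_eq_and {w : List Bool} (hw : InF w) (Q : Finset ℕ → Prop)
    [DecidablePred Q] :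
    {c | word j (e.path c) = w ∧ Q (markedPositions j (e.path c))}.ncard =
      ((occurrences j w).powerset.filter Q).card := by
  simpa using e.ncard_setOf_word_mem (A := {w}) (by simpa using hw) Q

lemma ncard_setOf_word_eq {w : List Bool} (hw : InF w) :
    {c | word j (e.path c) = w}.ncard = 2 ^ (occurrences j w).card := by
  simpa using e.ncard_setOf_word_eq_and hw fun _ => True

lemma ncard_marked_and_ncard_not_marked {w : List Bool} (hw : InF w) (h : ¬ Avoids j w) :
    {c | word j (e.path c) = w ∧ (ruleTree j).marked c = true}.ncard =
        2 ^ ((occurrences j w).card - 1) ∧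
      {c | word j (e.path c) = w ∧ (ruleTree j).marked c = false}.ncard =
        2 ^ ((occurrences j w).card - 1) := by
  simp only [e.marked_iff, e.not_marked_iff]
  rw [e.ncard_setOf_word_eq_and hw fun S => Odd S.card,
    e.ncard_setOf_word_eq_and hw fun S => Even S.card]
  exact card_odd_and_card_even_powerset (Finset.nonempty_iff_ne_empty.2 (mt avoids_iff.2 h))

lemma markedPositions_eq_empty {c : (ruleTree j).Node} (h : Avoids j (word j (e.path c))) :
    markedPositions j (e.path c) = ∅ :=
  Finset.subset_empty.1 (avoids_iff.1 h ▸ markedPositions_subset j (e.path c))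

lemma existsUnique_word_eq_of_avoids {w : List Bool} (hw : InF w) (h : Avoids j w) :
    ∃! c, word j (e.path c) = w := by
  obtain ⟨c, ⟨rfl, hc⟩, -⟩ := e.existsUnique_node hw (Finset.empty_subset _)
  refine ⟨c, rfl, fun c' hc' => e.eq_of_word_eq hc' ?_⟩
  rw [hc, e.markedPositions_eq_empty (hc' ▸ h)]

lemma not_marked_of_avoids {c : (ruleTree j).Node} (h : Avoids j (word j (e.path c))) :
    (ruleTree j).marked c = false := by
  rw [e.not_marked_iff, e.markedPositions_eq_empty h]
  exact Even.zero

lemma existsUnique_symmDiff_singleton (c : (ruleTree j).Node) {m : ℕ}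
    (hm : m ∈ occurrences j (word j (e.path c))) :
    ∃! c', word j (e.path c') = word j (e.path c) ∧
      markedPositions j (e.path c') = symmDiff (markedPositions j (e.path c)) {m} ∧
      (ruleTree j).level c' = (ruleTree j).level c ∧
      (ruleTree j).value c' = (ruleTree j).value c ∧
      (ruleTree j).marked c' = !(ruleTree j).marked c := by
  have hS : symmDiff (markedPositions j (e.path c)) {m} ⊆ occurrences j (word j (e.path c)) :=
    Finset.symmDiff_subset_union.trans
      (Finset.union_subset (markedPositions_subset j _) (Finset.singleton_subset_iff.2 hm))
  obtain ⟨c', ⟨hw, hm'⟩, huniq⟩ := e.existsUnique_node (e.inF_word_path c) hS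
  refine ⟨c', ⟨hw, hm', ?_, ?_, ?_⟩, fun c'' h => huniq c'' ⟨h.1, h.2.1⟩⟩
  · rw [e.level_eq, e.level_eq, hw]
  · rw [e.value_eq, e.value_eq, hw]
  · rw [Bool.eq_iff_iff, Bool.not_eq_true', ← Bool.not_eq_true, e.marked_iff, e.marked_iff, hm',
      odd_card_symmDiff_singleton]

lemma ncard_not_marked_sub_ncard_marked {P : List Bool → Prop} (hP : {w | InF w ∧ P w}.Finite) :
    ({c | P (word j (e.path c)) ∧ (ruleTree j).marked c = false}.ncard : ℤ) -
      {c | P (word j (e.path c)) ∧ (ruleTree j).marked c = true}.ncard =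
        {w | InF w ∧ Avoids j w ∧ P w}.ncard := by
  have hcount : ∀ (Q : Finset ℕ → Prop) [DecidablePred Q],
      {c | P (word j (e.path c)) ∧ Q (markedPositions j (e.path c))}.ncard =
        ∑ w ∈ hP.toFinset, ((occurrences j w).powerset.filter Q).card := fun Q _ => by
    rw [← e.ncard_setOf_word_mem fun w hw => (hP.mem_toFinset.1 hw).1]
    simp only [hP.mem_toFinset, Set.mem_ofPred_eq, e.inF_word_path, true_and]
  have havoid : {w | InF w ∧ Avoids j w ∧ P w} =
      (hP.toFinset.filter fun w => occurrences j w = ∅ : Set (List Bool)) := by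
    ext w
    simp only [Finset.coe_filter, hP.mem_toFinset, Set.mem_ofPred_eq, avoids_iff]
    tauto
  simp only [e.marked_iff, e.not_marked_iff]
  rw [hcount fun S => Even S.card, hcount fun S => Odd S.card, havoid, Set.ncard_coe_finset,
    Nat.cast_sum, Nat.cast_sum, ← Finset.sum_sub_distrib,
    Finset.sum_congr rfl fun w _ => card_even_sub_card_odd (occurrences j w), Finset.sum_boole]

end LabelledDigraph.Iso

lemma finite_setOf_level_eq (j n : ℕ) : {c | (ruleTree j).level c = n}.Finite := by
  have hfin := finite_setOf_inF_count_true_eq n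
  have hbij := (treeIso j).bijOn_word_markedPositions (A := hfin.toFinset)
    (fun w hw => (hfin.mem_toFinset.1 hw).1) fun _ => True
  refine (hbij.finite_iff_finite.2 (Finset.finite_toSet _)).subset fun c hc => ?_
  exact ⟨hfin.mem_toFinset.2 ⟨(treeIso j).inF_word_path c, ((treeIso j).level_eq c).symm.trans hc⟩,
    trivial⟩

end PatternTree


theorem mainTheorem1 (j : ℕ) (hj : 1 ≤ j) :
    (PatternTree.pathTree j).IsRootedTree ∧
    ∃ e : (PatternTree.ruleTree j).Iso (PatternTree.pathTree j),
      -- every path of `F`, with every choice of marked forbidden patterns, is generated once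
      (∀ w, PatternTree.InF w → ∀ S ⊆ PatternTree.occurrences j w,
        ∃! c, PatternTree.word j (e.path c) = w ∧ PatternTree.markedPositions j (e.path c) = S) ∧
      -- the marked forbidden patterns are occurrences of the pattern, and the label is marked
      -- exactly if their number is odd
      (∀ c, PatternTree.markedPositions j (e.path c) ⊆
          PatternTree.occurrences j (PatternTree.word j (e.path c)) ∧
        ((PatternTree.ruleTree j).marked c = true ↔
          Odd (PatternTree.markedPositions j (e.path c)).card)) ∧
      -- a path with `C` forbidden patterns is generated `2 ^ C` times
      (∀ w, PatternTree.InF w →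
        {c | PatternTree.word j (e.path c) = w}.ncard =
          2 ^ (PatternTree.occurrences j w).card) ∧
      -- if `C ≥ 1` then half of the copies are marked and half are not
      (∀ w, PatternTree.InF w → ¬ PatternTree.Avoids j w →
        {c | PatternTree.word j (e.path c) = w ∧
            (PatternTree.ruleTree j).marked c = true}.ncard =
          2 ^ ((PatternTree.occurrences j w).card - 1) ∧
        {c | PatternTree.word j (e.path c) = w ∧
            (PatternTree.ruleTree j).marked c = false}.ncard =
          2 ^ ((PatternTree.occurrences j w).card - 1)) ∧
      -- a path that avoids the pattern is generated exactly once, with a non-marked label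
      (∀ w, PatternTree.InF w → PatternTree.Avoids j w →
        (∃! c, PatternTree.word j (e.path c) = w) ∧
        ∀ c, PatternTree.word j (e.path c) = w → (PatternTree.ruleTree j).marked c = false) ∧
      -- a generated path that contains the pattern is killed by exactly one other copy of it, on
      -- the same level, with the opposite label, and with the mark of the last pattern changed
      (∀ c m, IsGreatest
          (PatternTree.occurrences j (PatternTree.word j (e.path c)) : Set ℕ) m →
        ∃! c', PatternTree.word j (e.path c') = PatternTree.word j (e.path c) ∧
          PatternTree.markedPositions j (e.path c') =
            symmDiff (PatternTree.markedPositions j (e.path c)) {m} ∧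
          (PatternTree.ruleTree j).level c' = (PatternTree.ruleTree j).level c ∧
          (PatternTree.ruleTree j).value c' = (PatternTree.ruleTree j).value c ∧
          (PatternTree.ruleTree j).marked c' = !(PatternTree.ruleTree j).marked c) ∧
      -- the levels of the tree are finite
      (∀ n, {c | (PatternTree.ruleTree j).level c = n}.Finite) ∧
      -- after cancellation, level `n` counts the paths of `F` that avoid the pattern and have `n`
      -- ones, by the ordinate of the endpoint and in total
      (∀ n k : ℕ,
        ({c | (PatternTree.ruleTree j).level c = n ∧ (PatternTree.ruleTree j).value c = k ∧
            (PatternTree.ruleTree j).marked c = false}.ncard : ℤ) -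
          ({c | (PatternTree.ruleTree j).level c = n ∧ (PatternTree.ruleTree j).value c = k ∧
            (PatternTree.ruleTree j).marked c = true}.ncard : ℤ) =
          ({w | PatternTree.InF w ∧ PatternTree.Avoids j w ∧ w.count true = n ∧
            PatternTree.ordinate w = k}.ncard : ℤ)) ∧
      (∀ n : ℕ,
        ({c | (PatternTree.ruleTree j).level c = n ∧
            (PatternTree.ruleTree j).marked c = false}.ncard : ℤ) -
          ({c | (PatternTree.ruleTree j).level c = n ∧
            (PatternTree.ruleTree j).marked c = true}.ncard : ℤ) =
          ({w | PatternTree.InF w ∧ PatternTree.Avoids j w ∧ w.count true = n}.ncard : ℤ)) := by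
  open PatternTree in
  let e := treeIso j
  refine ⟨e.isRootedTree (ruleTree_isRootedTree j), e,
    fun w hw S hS => e.existsUnique_node hw hS,
    fun c => ⟨markedPositions_subset j _, e.marked_iff⟩,
    fun w hw => e.ncard_setOf_word_eq hw,
    fun w hw h => e.ncard_marked_and_ncard_not_marked hw h,
    fun w hw h => ⟨e.existsUnique_word_eq_of_avoids hw h,
      fun c hc => e.not_marked_of_avoids (hc ▸ h)⟩,
    fun c m hm => e.existsUnique_symmDiff_singleton c hm.1,
    fun n => finite_setOf_level_eq j n, fun n k => ?_, fun n => ?_⟩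
  · have hfin := (finite_setOf_inF_count_true_eq n).subset fun w
      (h : InF w ∧ w.count true = n ∧ ordinate w = k) => ⟨h.1, h.2.1⟩
    simpa only [e.level_eq, e.value_eq_iff, and_assoc] using
      e.ncard_not_marked_sub_ncard_marked hfin
  · simpa only [e.level_eq] using
      e.ncard_not_marked_sub_ncard_marked (finite_setOf_inF_count_true_eq n)
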